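/- Let $n\ge 3$ be odd and let $\beta: S^n\to S^n$ be a homeomorphism which is a limit of periodic homeomorphisms in the following sense: there are homeomorphisms $T_i: S^n\to S^n$ and integers $M_i\ge 1$ ($i\in\mathbb N$) with $T_i^{M_i}=\mathrm{id}$, $M_i\mid M_{i+1}$, and $$\sup_{t\in S^n,\ 1\le j\le M_i}\bigl|\beta^j(t)-T_i^j(t)\bigr|\longrightarrow 0\qquad (i\to\infty).$$ By an odometer system $(X,\alpha)$ we mean $X=\varprojlim \mathbb Z/m_i$ (a Cantor set) with $\alpha(x)=x+1$, where $m_i\ge 2$, $m_i\mid m_{i+1}$ and $m_i\to\infty$. For an odometer system $(X,\alpha)$ let $A=C(X\times S^n)\rtimes_{\alpha\times\beta}\mathbb Z$ be the crossed product $C^*$-algebra, with canonical unitary $u$ satisfying $ufu^*=f\circ(\alpha\times\beta)^{-1}$ for $f\in C(X\times S^n)$, and for $y\in X$ let $$A_{\{y\}}=C^*\bigl(C(X\times S^n),\ u\,C_0((X\setminus\{y\})\times S^n)\bigr)\subset A .$$ Then there is an odometer system $(X,\alpha)$ such that for every $y\in X$, every finite subset $\mathcal F\subset A$ and every $\varepsilon>0$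 there is a projection $p\in A_{\{y\}}$ with (i) $\|pa-ap\|<\varepsilon$ for all $a\in\mathcal F$, (ii) $\operatorname{dist}(pap,\,pA_{\{y\}}p)<\varepsilon$ for all $a\in\mathcal F$, (iii) $\tau(1_A-p)<\varepsilon$ for all tracial states $\tau$ on $A$. -/

import Mathlib

open scoped ENNReal ComplexOrder

/-! ### The crossed product by a homeomorphism -/

section CrossedProduct

/-- A unital covariant representation of the system `(K, γ)` in a nonzero unital C⋆-algebra `B`:
a unital ⋆-homomorphism `π : C(K) → B` and a unitary `U ∈ B` with
`U π(f) U⋆ = π(f ∘ γ⁻¹)` for all `f ∈ C(K)`. -/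
structure CovariantRep {K : Type} [TopologicalSpace K] [CompactSpace K] (γ : K ≃ₜ K) :
    Type 1 where
  B : Type
  [cstar : CStarAlgebra B]
  [nontriv : Nontrivial B]
  π : C(K, ℂ) →⋆ₐ[ℂ] B
  U : B
  U_mem : U ∈ unitary B
  covariant : ∀ f : C(K, ℂ), U * π f * star U = π (f.comp (γ.symm : C(K, K)))

attribute [instance] CovariantRep.cstar CovariantRep.nontriv

variable {K : Type} [TopologicalSpace K] [CompactSpace K] (γ : K ≃ₜ K)

/-- The C⋆-algebra of all bounded families indexed by all covariant representations of `(K, γ)`,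
with pointwise operations and the supremum norm. -/
abbrev RepProduct : Type 1 := lp (fun ρ : CovariantRep γ => ρ.B) ∞

noncomputable instance RepProduct.instCStarAlgebra : CStarAlgebra (RepProduct γ) where
  toNormedRing := lp.inftyNormedRing
  toStarRing := lp.inftyStarRing
  toCompleteSpace := inferInstance
  toCStarRing := lp.inftyCStarRing
  toNormedAlgebra := lp.inftyNormedAlgebra
  toStarModule := inferInstance

/-- The universal copy of `C(K)`: `f` is sent to the family `(π(f))` over all covariant
representations `(π, U)`. -/
noncomputable def universalFun : C(K, ℂ) →⋆ₐ[ℂ] RepProduct γ where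
  toFun f := ⟨fun ρ => ρ.π f, memℓp_infty ⟨‖f‖, by
    rintro _ ⟨ρ, rfl⟩
    exact NonUnitalStarAlgHom.norm_apply_le ρ.π f⟩⟩
  map_one' := by ext ρ; exact map_one ρ.π
  map_mul' f g := by ext ρ; exact map_mul ρ.π f g
  map_zero' := by ext ρ; exact map_zero ρ.π
  map_add' f g := by ext ρ; exact map_add ρ.π f g
  commutes' c := by ext ρ; exact AlgHomClass.commutes ρ.π c
  map_star' f := by ext ρ; exact map_star ρ.π f

/-- The universal unitary: the family `(U)` over all covariant representations `(π, U)`. -/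
noncomputable def universalUnitary : RepProduct γ :=
  ⟨fun ρ => ρ.U, memℓp_infty ⟨1, by
    rintro _ ⟨ρ, rfl⟩
    exact (CStarRing.norm_of_mem_unitary ρ.U_mem).le⟩⟩

/-- The C⋆-subalgebra generated by `C(K)` and the unitary inside the product of all covariant
representations. -/
noncomputable def crossedProductSubalgebra : StarSubalgebra ℂ (RepProduct γ) :=
  (StarAlgebra.adjoin ℂ
    (Set.range (universalFun γ) ∪ {universalUnitary γ})).topologicalClosure

/-- The (full) crossed product C⋆-algebra `C(K) ⋊_γ ℤ`: the C⋆-algebra generated by a copy of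
`C(K)` and a unitary `u` with `u f u⋆ = f ∘ γ⁻¹`, universal for covariant representations of
`(K, γ)`. Its norm is the supremum of the norms in all covariant representations. -/
def CrossedProduct : Type 1 := crossedProductSubalgebra γ

noncomputable instance CrossedProduct.instCStarAlgebra : CStarAlgebra (CrossedProduct γ) :=
  haveI : IsClosed (crossedProductSubalgebra γ : Set (RepProduct γ)) :=
    StarSubalgebra.isClosed_topologicalClosure _
  inferInstanceAs (CStarAlgebra (crossedProductSubalgebra γ))

namespace CrossedProduct

/-- The canonical ⋆-homomorphism `C(K) → C(K) ⋊_γ ℤ`. -/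
noncomputable def ofFun : C(K, ℂ) →⋆ₐ[ℂ] CrossedProduct γ :=
  (universalFun γ).codRestrict (crossedProductSubalgebra γ) fun f =>
    StarSubalgebra.le_topologicalClosure _
      (StarAlgebra.subset_adjoin ℂ _ (Or.inl (Set.mem_range_self f)))

/-- The canonical unitary `u ∈ C(K) ⋊_γ ℤ` implementing `γ`. -/
noncomputable def u : CrossedProduct γ :=
  ⟨universalUnitary γ, StarSubalgebra.le_topologicalClosure _
    (StarAlgebra.subset_adjoin ℂ _ (Or.inr rfl))⟩

/-- The orbit-breaking subalgebra `C⋆(C(K), u C₀(K \ L))` of `C(K) ⋊_γ ℤ` for a subset `L ⊆ K`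
(meant for closed `L`): the C⋆-subalgebra generated by `C(K)` and all `u f`, where `f ∈ C(K)`
vanishes on `L`. -/
noncomputable def orbitBreaking (L : Set K) : StarSubalgebra ℂ (CrossedProduct γ) :=
  (StarAlgebra.adjoin ℂ
    (Set.range (ofFun γ) ∪
      {a | ∃ f : C(K, ℂ), (∀ x ∈ L, f x = 0) ∧ a = u γ * ofFun γ f})).topologicalClosure

end CrossedProduct

end CrossedProduct

/-- Tracial states on a unital C⋆-algebra: unital positive linear functionals with
`τ(ab) = τ(ba)`. -/
structure IsTracialState {A : Type*} [CStarAlgebra A] (τ : A →ₗ[ℂ] ℂ) : Prop where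
  map_one : τ 1 = 1
  nonneg : ∀ a : A, 0 ≤ τ (star a * a)
  map_mul_comm : ∀ a b : A, τ (a * b) = τ (b * a)

/-! ### Odometers -/

/-- The data of an odometer: integers `m i ≥ 2` with `m i ∣ m (i + 1)`, unbounded
(equivalently, the inverse limit of the `ℤ/(m i)` is infinite, i.e. a Cantor set). -/
structure OdometerData where
  m : ℕ → ℕ
  two_le : ∀ i, 2 ≤ m i
  dvd : ∀ i, m i ∣ m (i + 1)
  unbounded : Filter.Tendsto m Filter.atTop Filter.atTop

/-- The underlying space of the odometer: the inverse limit of the discrete groups `ℤ/(m i)` along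
reduction modulo `m i`. -/
def Odometer (D : OdometerData) : Type :=
  {x : (i : ℕ) → ZMod (D.m i) // ∀ i, ZMod.castHom (D.dvd i) (ZMod (D.m i)) (x (i + 1)) = x i}

namespace Odometer

variable (D : OdometerData)

instance : TopologicalSpace (Odometer D) :=
  inferInstanceAs (TopologicalSpace
    {x : (i : ℕ) → ZMod (D.m i) //
      ∀ i, ZMod.castHom (D.dvd i) (ZMod (D.m i)) (x (i + 1)) = x i})

instance : CompactSpace (Odometer D) := by
  have : ∀ i, NeZero (D.m i) := fun i => ⟨by have := D.two_le i; omega⟩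
  have h : IsClosed {x : (i : ℕ) → ZMod (D.m i) |
      ∀ i, ZMod.castHom (D.dvd i) (ZMod (D.m i)) (x (i + 1)) = x i} := by
    rw [Set.ofPred_forall]
    refine isClosed_iInter fun i => isClosed_eq ?_ (continuous_apply i)
    exact continuous_of_discreteTopology.comp (continuous_apply (i + 1))
  exact isCompact_iff_compactSpace.mp h.isCompact

/-- The odometer action `x ↦ x + 1`. -/
def addOne : Odometer D ≃ₜ Odometer D where
  toFun x := ⟨fun i => x.1 i + 1, fun i => by rw [map_add, map_one, x.2 i]⟩
  invFun x := ⟨fun i => x.1 i - 1, fun i => by rw [map_sub, map_one, x.2 i]⟩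
  left_inv x := Subtype.ext (funext fun i => add_sub_cancel_right _ _)
  right_inv x := Subtype.ext (funext fun i => sub_add_cancel _ _)
  continuous_toFun := Continuous.subtype_mk (continuous_pi fun i =>
    (continuous_of_discreteTopology (f := fun z : ZMod (D.m i) => z + 1)).comp
      ((continuous_apply i).comp continuous_subtype_val)) _
  continuous_invFun := Continuous.subtype_mk (continuous_pi fun i =>
    (continuous_of_discreteTopology (f := fun z : ZMod (D.m i) => z - 1)).comp
      ((continuous_apply i).comp continuous_subtype_val)) _

end Odometer

/-! ### Homeomorphisms of spheres that are limits of periodic ones -/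

/-- The unit sphere `Sⁿ` in `ℝⁿ⁺¹`, with the Euclidean distance of `ℝⁿ⁺¹`. -/
abbrev UnitSphere (n : ℕ) : Type := Metric.sphere (0 : EuclideanSpace ℝ (Fin (n + 1))) 1

/-- `β` is the limit of a sequence of periodic homeomorphisms `T i` of period `M i ≥ 1`
(i.e. `(T i)^(M i) = id`), where `M i ∣ M (i + 1)`, in the sense that
`sup {|β^j t - (T i)^j t| : t ∈ Sⁿ, 1 ≤ j ≤ M i} → 0` as `i → ∞`. -/
def IsLimitOfPeriodic {n : ℕ} (β : UnitSphere n ≃ₜ UnitSphere n) : Prop :=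
  ∃ (T : ℕ → (UnitSphere n ≃ₜ UnitSphere n)) (M : ℕ → ℕ),
    (∀ i, 1 ≤ M i) ∧ (∀ i, M i ∣ M (i + 1)) ∧ (∀ i t, (T i)^[M i] t = t) ∧
    ∀ δ : ℝ, 0 < δ → ∀ᶠ i in Filter.atTop, ∀ t : UnitSphere n, ∀ j ∈ Finset.Icc 1 (M i),
      dist (β^[j] t) ((T i)^[j] t) ≤ δ

/-- The product homeomorphism `α × β` of `X × Sⁿ`, for `(X, α)` the odometer given by `D`. -/
def odometerProd {n : ℕ} (D : OdometerData) (β : UnitSphere n ≃ₜ UnitSphere n) :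
    (Odometer D × UnitSphere n) ≃ₜ (Odometer D × UnitSphere n) :=
  (Odometer.addOne D).prodCongr β

/-- The subalgebra `A_{y} = C⋆(C(X × Sⁿ), u C₀((X \ {y}) × Sⁿ))` of
`A = C(X × Sⁿ) ⋊_{α × β} ℤ`. -/
noncomputable def fibreBreaking {n : ℕ} (D : OdometerData) (β : UnitSphere n ≃ₜ UnitSphere n)
    (y : Odometer D) : StarSubalgebra ℂ (CrossedProduct (odometerProd D β)) :=
  CrossedProduct.orbitBreaking (odometerProd D β) ({y} ×ˢ Set.univ)

/-! ### The rotation profile on `ℤ/m` -/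

/-! The odometer is built from the approximate periods of `β`, so that `β^(m i)`, and hence `(α ×
β)^(m i)`, tends uniformly to the identity. For such a system a Berg-type rotation removes the fibre
over `y`.

Take `m = m i` much larger than `N = m j`, with `N ≥ r` and `r` large. Cut `X` into `m` cyclically
permuted levels with `y` at height `r`, and let `V = (u⋆)^(m - N)`. On functions of the level, `V`
moves up by `N`, because it goes down `m - N` steps round a cycle of length `m`. Put `e = d + V s +
s V⋆`. The profile `d` climbs from 0 to 1 on `[0, r]`, stays 1 up to `N`, and falls back to 0 on
`[N, N + r]`. With `s = √(d(1 - d))` on `[0, r]`, the levels `x` and `x + N` carry the projection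
matrix with diagonal `t, 1 - t` and off-diagonal `√(t(1 - t))`.

The required projection is `p = 1 - e`: - `e` lies in `A_{y}`, since the backward route from `(0,
r)` to `(N, N + r)` never makes the step between heights `r` and `r + 1`, whereas the forward route
would (`rotation_mem`). - `e` almost commutes with `u`, since `V` is a power of `u⋆` and the
profiles vary slowly. It almost commutes with `C(X × Sⁿ)`, since `m` and `N` are both approximate
return times. - `e` is 1 on the level of `y`, so `p u p = p u (1 - χ) p` with `χ` the indicator of
that level, and `u (1 - χ)` is in `A_{y}`. - Traces see only `d`, so `τ(e) ≤ (N + r) / m`, which is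
small.

Letting `r`, `j`, `i` grow gives one sequence of projections. The asymptotic properties pass from
the generators to all of `A`. -/

section Profile

/-- The ramp `t ↦ t / r`, clamped to `[0, 1]`. -/
noncomputable def ramp (r : ℕ) (t : ℝ) : ℝ := max 0 (min 1 (t / r))

lemma ramp_nonneg (r : ℕ) (t : ℝ) : 0 ≤ ramp r t := le_max_left _ _

lemma ramp_le_one (r : ℕ) (t : ℝ) : ramp r t ≤ 1 := max_le zero_le_one (min_le_left _ _)

lemma ramp_of_nonpos (r : ℕ) {t : ℝ} (ht : t ≤ 0) : ramp r t = 0 :=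
  max_eq_left ((min_le_right _ _).trans (div_nonpos_of_nonpos_of_nonneg ht r.cast_nonneg))

lemma ramp_of_le {r : ℕ} (hr : 0 < r) {t : ℝ} (ht : (r : ℝ) ≤ t) : ramp r t = 1 := by
  have h : 1 ≤ t / r := (one_le_div (by exact_mod_cast hr)).2 ht
  simp [ramp, min_eq_left h]

lemma abs_ramp_sub_ramp_le (r : ℕ) (s t : ℝ) : |ramp r s - ramp r t| ≤ |s - t| / r := by
  have h₁ := abs_max_sub_max_le_max 0 (min 1 (s / r)) 0 (min 1 (t / r))
  have h₂ := abs_min_sub_min_le_max 1 (s / r) 1 (t / r)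
  simp only [sub_self, abs_zero, abs_nonneg, sup_of_le_right] at h₁ h₂
  refine (h₁.trans h₂).trans (le_of_eq ?_)
  rw [← sub_div, abs_div, Nat.abs_cast]

/-- The diagonal coefficient of the rotation projection. -/
noncomputable def diagCoeff (r N i : ℕ) : ℝ := ramp r i - ramp r ((i : ℝ) - N)

/-- The off-diagonal coefficient of the rotation projection. -/
noncomputable def offCoeff (r i : ℕ) : ℝ := √(ramp r i * (1 - ramp r i))

lemma offCoeff_sq (r i : ℕ) : offCoeff r i * offCoeff r i = ramp r i * (1 - ramp r i) :=
  Real.mul_self_sqrt (mul_nonneg (ramp_nonneg _ _) (sub_nonneg.2 (ramp_le_one _ _)))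

lemma offCoeff_of_le {r i : ℕ} (hr : 0 < r) (hi : r ≤ i) : offCoeff r i = 0 := by
  rw [offCoeff, ramp_of_le hr (by exact_mod_cast hi)]; simp

lemma offCoeff_zero (r : ℕ) : offCoeff r 0 = 0 := by
  rw [offCoeff, ramp_of_nonpos r (by simp)]; simp

lemma abs_offCoeff_le_one (r i : ℕ) : |offCoeff r i| ≤ 1 := by
  rw [offCoeff, abs_of_nonneg (Real.sqrt_nonneg _)]
  have h₀ := ramp_nonneg r i
  have h₁ := ramp_le_one r i
  exact Real.sqrt_le_one.2 (by nlinarith)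

/-- The map `t ↦ t(1 - t)` is 1-Lipschitz on `[0, 1]`, but the square root is only Hölder at 0. From
`|√a - √b| ≤ √|a - b|` the increment is of order `r^(-1/2)`, not `1/r`. -/
lemma abs_offCoeff_succ_sub_le (r i : ℕ) :
    |offCoeff r (i + 1) - offCoeff r i| ≤ √(1 / r) := by
  have key : |ramp r (i + 1 : ℕ) * (1 - ramp r (i + 1 : ℕ)) - ramp r i * (1 - ramp r i)|
      ≤ 1 / r := by
    have h := abs_ramp_sub_ramp_le r (i + 1 : ℕ) i
    rw [show ((i + 1 : ℕ) : ℝ) - i = 1 by push_cast; ring, abs_one] at h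
    rw [show ramp r (i + 1 : ℕ) * (1 - ramp r (i + 1 : ℕ)) - ramp r i * (1 - ramp r i)
      = (ramp r (i + 1 : ℕ) - ramp r i) * (1 - ramp r (i + 1 : ℕ) - ramp r i) by ring, abs_mul]
    have h' : |1 - ramp r (i + 1 : ℕ) - ramp r i| ≤ 1 := by
      have := ramp_nonneg r i
      have := ramp_le_one r i
      have := ramp_nonneg r (i + 1 : ℕ)
      have := ramp_le_one r (i + 1 : ℕ)
      exact abs_le.2 ⟨by linarith, by linarith⟩
    calc _ ≤ |ramp r (i + 1 : ℕ) - ramp r i| * 1 := by gcongr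
      _ ≤ _ := by simpa using h
  have hsq : ∀ a b : ℝ, 0 ≤ b → √a - √b ≤ √|a - b| := fun a b hb => by
    have h₁ : a ≤ (√b + √|a - b|) ^ 2 := by
      have := Real.sq_sqrt hb
      have := Real.sq_sqrt (abs_nonneg (a - b))
      have := le_abs_self (a - b)
      have := mul_nonneg (Real.sqrt_nonneg b) (Real.sqrt_nonneg |a - b|)
      nlinarith
    have := Real.sqrt_le_sqrt h₁
    rw [Real.sqrt_sq (by positivity)] at this
    linarith
  have hn : ∀ j : ℕ, 0 ≤ ramp r j * (1 - ramp r j) := fun j =>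
    mul_nonneg (ramp_nonneg _ _) (sub_nonneg.2 (ramp_le_one _ _))
  refine (abs_sub_le_iff.2 ⟨hsq _ _ (hn i), ?_⟩).trans (Real.sqrt_le_sqrt key)
  rw [abs_sub_comm]
  exact hsq _ _ (hn (i + 1))

lemma diagCoeff_le_one (r N i : ℕ) : diagCoeff r N i ≤ 1 := by
  have := ramp_le_one r i
  have := ramp_nonneg r ((i : ℝ) - N)
  unfold diagCoeff
  linarith

lemma diagCoeff_of_le_left {r N i : ℕ} (hi : i ≤ N) : diagCoeff r N i = ramp r i := by
  have : (i : ℝ) ≤ N := by exact_mod_cast hi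
  rw [diagCoeff, ramp_of_nonpos r (by linarith : (i : ℝ) - N ≤ 0), sub_zero]

lemma diagCoeff_of_le_right {r N i : ℕ} (hr : 0 < r) (hrN : r ≤ N) (hi : N ≤ i) :
    diagCoeff r N i = 1 - ramp r (i - N : ℕ) := by
  rw [diagCoeff, ramp_of_le hr (by exact_mod_cast hrN.trans hi), Nat.cast_sub hi]

lemma diagCoeff_of_add_le {r N i : ℕ} (hr : 0 < r) (hi : N + r ≤ i) : diagCoeff r N i = 0 := by
  have : (N : ℝ) + r ≤ i := by exact_mod_cast hi
  rw [diagCoeff, ramp_of_le hr (by exact_mod_cast (by lia : r ≤ i)),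
    ramp_of_le hr (by linarith), sub_self]

lemma abs_diagCoeff_succ_sub_le (r N i : ℕ) :
    |diagCoeff r N (i + 1) - diagCoeff r N i| ≤ 2 / r := by
  have h₁ := abs_ramp_sub_ramp_le r (i + 1 : ℕ) i
  have h₂ := abs_ramp_sub_ramp_le r ((i + 1 : ℕ) - N) ((i : ℝ) - N)
  rw [show ((i + 1 : ℕ) : ℝ) - i = 1 by push_cast; ring, abs_one] at h₁
  rw [show ((i + 1 : ℕ) : ℝ) - N - (i - N) = 1 by push_cast; ring, abs_one] at h₂
  have h : (2 : ℝ) / r = 1 / r + 1 / r := by ring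
  rw [abs_le] at *
  unfold diagCoeff
  constructor <;> linarith [h₁.1, h₁.2, h₂.1, h₂.2]

variable {m : ℕ} [NeZero m]

omit [NeZero m] in
lemma ZMod.val_sub_natCast_of_lt {N : ℕ} (hN : N < m) {x : ZMod m} (hx : x.val < N) :
    (x - N).val = x.val + m - N := by
  have h : x - N = x + ((m - N : ℕ) : ZMod m) := by
    rw [Nat.cast_sub hN.le, ZMod.natCast_self]; ring
  rw [h, ZMod.val_add_of_lt, ZMod.val_cast_of_lt (by lia)]
  · lia
  · rw [ZMod.val_cast_of_lt (by lia)]; lia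

/-- The condition `f m = f 0` makes the passage from the top level back to the bottom an ordinary
unit step, so increment bounds on `ℕ` hold cyclically. -/
lemma ZMod.apply_val_add_one {f : ℕ → ℝ} (hf : f m = f 0) (hm : 1 < m) (x : ZMod m) :
    f (x + 1).val = f (x.val + 1) := by
  have : Fact (1 < m) := ⟨hm⟩
  have h₁ : (1 : ZMod m).val = 1 := ZMod.val_one m
  have hx := x.val_lt
  rcases (show x.val + 1 < m ∨ x.val + 1 = m by lia) with h | h
  · rw [ZMod.val_add_of_lt (by lia), h₁]
  · rw [ZMod.val_add_of_le (by lia), h₁, h, Nat.sub_self, hf]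

/-- The diagonal coefficient as a function on `ℤ/m`. -/
noncomputable def diagFun (m r N : ℕ) (x : ZMod m) : ℂ := (diagCoeff r N x.val : ℝ)

/-- The off-diagonal coefficient as a function on `ℤ/m`. -/
noncomputable def offFun (m r : ℕ) (x : ZMod m) : ℂ := (offCoeff r x.val : ℝ)

variable {r N : ℕ}

omit [NeZero m] in
lemma offFun_ne_zero (hr : 0 < r) {x : ZMod m} (hx : offFun m r x ≠ 0) :
    0 < x.val ∧ x.val < r := by
  constructor
  · rw [Nat.pos_iff_ne_zero]
    intro h
    exact hx (by rw [offFun, h, offCoeff_zero, Complex.ofReal_zero])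
  · by_contra! h
    exact hx (by rw [offFun, offCoeff_of_le hr h, Complex.ofReal_zero])

omit [NeZero m] in
lemma val_add_of_offFun_ne_zero (hr : 0 < r) (hm : N + r ≤ m) {x : ZMod m}
    (hx : offFun m r x ≠ 0) : (x + N).val = x.val + N := by
  have h := offFun_ne_zero hr hx
  have hN : (N : ZMod m).val = N := ZMod.val_cast_of_lt (by lia)
  rw [ZMod.val_add_of_lt (by lia), hN]

omit [NeZero m] in
lemma offFun_mul_shift (hr : 0 < r) (hrN : r ≤ N) (hm : N + r ≤ m) (x : ZMod m) :
    offFun m r x * offFun m r (x + N) = 0 := by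
  by_cases hx : offFun m r x = 0
  · rw [hx, zero_mul]
  · rw [offFun, offFun, val_add_of_offFun_ne_zero hr hm hx,
      offCoeff_of_le hr (by lia : r ≤ x.val + N),
      Complex.ofReal_zero, mul_zero]

-- On the support of `s` the two diagonal entries at `x` and `x + N` are `t` and `1 - t`. This is
-- the off-diagonal part of `e² = e`.
omit [NeZero m] in
lemma offFun_mul_diagFun (hr : 0 < r) (hrN : r ≤ N) (hm : N + r ≤ m) (x : ZMod m) :
    offFun m r x * (diagFun m r N x + diagFun m r N (x + N)) = offFun m r x := by
  by_cases hx : offFun m r x = 0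
  · rw [hx, zero_mul]
  · have h := offFun_ne_zero hr hx
    rw [diagFun, diagFun, val_add_of_offFun_ne_zero hr hm hx, diagCoeff_of_le_left (by lia),
      diagCoeff_of_le_right hr hrN (by lia), Nat.add_sub_cancel]
    push_cast
    ring

/-- The diagonal part of `e² = e`. Only one off-diagonal term survives at each level: below `N`, the
level `x - N` wraps to a height at least `m - N ≥ r`, where `s = 0`; from `N` on, `s` vanishes at
`x` itself. -/
lemma diagFun_eq (hr : 0 < r) (hrN : r ≤ N) (hm : N + r ≤ m) (x : ZMod m) :
    diagFun m r N x * diagFun m r N x + offFun m r x * offFun m r x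
      + offFun m r (x - N) * offFun m r (x - N) = diagFun m r N x := by
  simp only [diagFun, offFun]
  rw [← Complex.ofReal_mul, ← Complex.ofReal_mul, ← Complex.ofReal_mul, ← Complex.ofReal_add,
    ← Complex.ofReal_add, Complex.ofReal_inj, offCoeff_sq, offCoeff_sq]
  rcases lt_or_ge x.val N with h | h
  · rw [ZMod.val_sub_natCast_of_lt (by lia) h, diagCoeff_of_le_left h.le,
      ramp_of_le (t := (x.val + m - N : ℕ)) hr (by exact_mod_cast (by lia : r ≤ x.val + m - N))]
    ring
  · have hN : (N : ZMod m).val = N := ZMod.val_cast_of_lt (by lia)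
    rw [ZMod.val_sub (by rwa [hN]), hN, diagCoeff_of_le_right hr hrN h,
      ramp_of_le hr (by exact_mod_cast hrN.trans h : (r : ℝ) ≤ x.val)]
    ring

lemma norm_diagFun_succ_sub_le (hr : 0 < r) (hrN : r ≤ N) (hm : N + r ≤ m) (x : ZMod m) :
    ‖diagFun m r N (x + 1) - diagFun m r N x‖ ≤ 2 / r := by
  rw [diagFun, diagFun, ← Complex.ofReal_sub, Complex.norm_real, Real.norm_eq_abs,
    ZMod.apply_val_add_one (f := diagCoeff r N) _ (by lia)]
  · exact abs_diagCoeff_succ_sub_le _ _ _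
  · rw [diagCoeff_of_add_le hr hm, diagCoeff_of_le_left (Nat.zero_le _),
      ramp_of_nonpos _ (by simp)]

lemma norm_offFun_succ_sub_le (hr : 0 < r) (hm : r < m) (x : ZMod m) :
    ‖offFun m r (x + 1) - offFun m r x‖ ≤ √(1 / r) := by
  rw [offFun, offFun, ← Complex.ofReal_sub, Complex.norm_real, Real.norm_eq_abs,
    ZMod.apply_val_add_one (f := offCoeff r) _ (by lia)]
  · exact abs_offCoeff_succ_sub_le _ _
  · rw [offCoeff_of_le hr hm.le, offCoeff_zero]

omit [NeZero m] in
lemma norm_offFun_le_one (x : ZMod m) : ‖offFun m r x‖ ≤ 1 := by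
  rw [offFun, Complex.norm_real]
  exact abs_offCoeff_le_one _ _

lemma re_sum_diagFun_le (hr : 0 < r) : (∑ x : ZMod m, diagFun m r N x).re ≤ N + r := by
  rw [Complex.re_sum]
  calc ∑ x : ZMod m, (diagFun m r N x).re
      ≤ ∑ x : ZMod m, if x.val ∈ Finset.range (N + r) then (1 : ℝ) else 0 := by
        refine Finset.sum_le_sum fun x _ => ?_
        rw [diagFun, Complex.ofReal_re]
        split_ifs with h
        · exact diagCoeff_le_one _ _ _
        · exact (diagCoeff_of_add_le hr (by simpa using h)).le
    _ = (Finset.univ.filter fun x : ZMod m => x.val ∈ Finset.range (N + r)).card := by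
        rw [Finset.sum_ite, Finset.sum_const_zero, add_zero, Finset.sum_const, nsmul_one]
    _ ≤ N + r := by
        have := Finset.card_le_card_of_injOn (s := Finset.univ.filter
          fun x : ZMod m => x.val ∈ Finset.range (N + r)) (t := Finset.range (N + r))
          ZMod.val (fun x hx => by simpa using hx) (fun x _ y _ h => ZMod.val_injective m h)
        rw [Finset.card_range] at this
        exact_mod_cast this

end Profile

/-! ### Cyclic towers in C⋆-algebras -/

lemma norm_le_one_of_mem_unitary {A : Type*} [CStarAlgebra A] {v : A} (hv : v ∈ unitary A) :
    ‖v‖ ≤ 1 := by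
  rcases subsingleton_or_nontrivial A with _ | _
  · rw [Subsingleton.elim v 0, norm_zero]
    exact zero_le_one
  · exact (CStarRing.norm_of_mem_unitary hv).le

/-- A copy `H` of the functions on `ℤ/m` in a C⋆-algebra, cyclically permuted by a unitary `u`. -/
structure CyclicTower (A : Type*) [CStarAlgebra A] (m : ℕ) [NeZero m] where
  u : A
  u_mem : u ∈ unitary A
  H : (ZMod m → ℂ) →⋆ₐ[ℂ] A
  covariant : ∀ h, u * H h * star u = H (fun x => h (x - 1))

namespace CyclicTower

variable {A : Type*} [CStarAlgebra A] {m : ℕ} [NeZero m] (S : CyclicTower A m)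

lemma star_u_mul_u : star S.u * S.u = 1 := (Unitary.mem_iff.1 S.u_mem).1

lemma u_mul_star_u : S.u * star S.u = 1 := (Unitary.mem_iff.1 S.u_mem).2

lemma u_mul_H (h : ZMod m → ℂ) : S.u * S.H h = S.H (fun x => h (x - 1)) * S.u := by
  rw [← S.covariant, mul_assoc, S.star_u_mul_u, mul_one]

lemma star_u_mul_H (h : ZMod m → ℂ) :
    star S.u * S.H h = S.H (fun x => h (x + 1)) * star S.u := by
  have h' := S.covariant (fun x => h (x + 1))
  simp only [sub_add_cancel] at h'
  rw [← h', mul_assoc, ← mul_assoc (star S.u), S.star_u_mul_u, one_mul]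

lemma star_u_pow_mul_H (l : ℕ) (h : ZMod m → ℂ) :
    star S.u ^ l * S.H h = S.H (fun x => h (x + l)) * star S.u ^ l := by
  induction l generalizing h with
  | zero => simp
  | succ l ih =>
    rw [pow_succ', mul_assoc, ih, ← mul_assoc, star_u_mul_H, mul_assoc]
    congr 3
    funext x
    congr 1
    push_cast
    ring

lemma norm_H_le {h : ZMod m → ℂ} {C : ℝ} (hC : 0 ≤ C) (hh : ∀ x, ‖h x‖ ≤ C) : ‖S.H h‖ ≤ C :=
  (NonUnitalStarAlgHom.norm_apply_le S.H h).trans ((pi_norm_le_iff_of_nonneg hC).2 hh)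

/-- A single factor `u⋆ H(h)` is the adjoint of some `u H(h')`, so it lies in `B` unless `h` charges
`x₀ + 1`. Inserting the indicator of the support between successive factors peels off one `u⋆` at a
time while tracking where the support has moved. -/
lemma star_u_pow_mul_H_mem {B : StarSubalgebra ℂ A} (hH : ∀ h, S.H h ∈ B) {x₀ : ZMod m}
    (hu : ∀ h : ZMod m → ℂ, h x₀ = 0 → S.u * S.H h ∈ B) (l : ℕ) (h : ZMod m → ℂ)
    (hh : ∀ x, h x ≠ 0 → ∀ j < l, x - (j : ℕ) ≠ x₀ + 1) : star S.u ^ l * S.H h ∈ B := by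
  induction l generalizing h with
  | zero => simpa using hH h
  | succ l ih =>
    have h₁ : star S.u * S.H h ∈ B := by
      have : star S.u * S.H h = star (S.u * S.H (star fun x => h (x + 1))) := by
        rw [star_mul, ← map_star, star_star, star_u_mul_H]
      rw [this]
      refine star_mem (hu _ ?_)
      by_contra hne
      exact hh (x₀ + 1) (fun h0 => hne (by simp [h0])) 0 (Nat.succ_pos l) (by simp)
    classical
    set g : ZMod m → ℂ := fun x => if h x = 0 then 0 else 1
    have hg : g * h = h := by
      funext x
      by_cases hx : h x = 0 <;> simp [g, hx]
    have h₂ : star S.u ^ (l + 1) * S.H h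
        = star S.u ^ l * S.H (fun x => g (x + 1)) * (star S.u * S.H h) := by
      calc star S.u ^ (l + 1) * S.H h = star S.u ^ l * (star S.u * S.H g) * S.H h := by
            rw [← mul_assoc, ← pow_succ, mul_assoc, ← map_mul, hg]
        _ = _ := by rw [star_u_mul_H]; simp only [mul_assoc]
    rw [h₂]
    refine mul_mem (ih _ fun x hx j hj hxj => ?_) h₁
    have hx' : h (x + 1) ≠ 0 := fun h0 => hx (by simp [g, h0])
    refine hh _ hx' (j + 1) (by lia) ?_
    rw [← hxj]
    push_cast
    ring

/-- All cyclic shifts of `h` are unitarily conjugate, hence have equal trace, and they add up to the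
constant `∑ x, h x`. -/
lemma tracial_H {τ : A →ₗ[ℂ] ℂ} (hτ : IsTracialState τ) (h : ZMod m → ℂ) :
    m * τ (S.H h) = ∑ x, h x := by
  have step : ∀ l : ℕ, τ (S.H fun x => h (x + l)) = τ (S.H h) := by
    intro l
    have hu : star S.u ^ l ∈ unitary A := pow_mem (Unitary.star_mem S.u_mem) l
    have : S.H (fun x => h (x + l)) = star S.u ^ l * S.H h * star (star S.u ^ l) := by
      rw [star_u_pow_mul_H, mul_assoc, (Unitary.mem_iff.1 hu).2, mul_one]
    rw [this, hτ.map_mul_comm, ← mul_assoc, (Unitary.mem_iff.1 hu).1, one_mul]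
  have hsum : ∑ y : ZMod m, τ (S.H fun x => h (x + y)) = ∑ x, h x := by
    rw [← map_sum, ← map_sum]
    have : (∑ y : ZMod m, fun x => h (x + y)) = (∑ x, h x) • (1 : ZMod m → ℂ) := by
      funext x
      simp only [Finset.sum_apply, Pi.smul_apply, Pi.one_apply, smul_eq_mul, mul_one]
      exact Fintype.sum_equiv (Equiv.addLeft x) _ _ fun y => rfl
    rw [this, map_smul, map_one, map_smul, hτ.map_one, smul_eq_mul, mul_one]
  have hconst : ∀ y : ZMod m, τ (S.H fun x => h (x + y)) = τ (S.H h) := fun y => by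
    simpa using step y.val
  rw [← hsum, Finset.sum_congr rfl fun y _ => hconst y]
  simp [ZMod.card]

/-! ### The rotation projection and its estimates -/

variable (r N : ℕ)

/-- The unitary implementing the transport by `N` levels, going backwards round the tower. -/
def transport : A := star S.u ^ (m - N)

/-- The projection rotating the levels `[0, r)` into the levels `[N, N + r)`. -/
noncomputable def rotation : A :=
  S.H (diagFun m r N) + S.transport N * S.H (offFun m r)
    + S.H (offFun m r) * star (S.transport N)

lemma transport_mem_unitary : S.transport N ∈ unitary A := pow_mem (Unitary.star_mem S.u_mem) _

lemma star_transport_mul : star (S.transport N) * S.transport N = 1 :=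
  (Unitary.mem_iff.1 (S.transport_mem_unitary N)).1

lemma transport_mul_star : S.transport N * star (S.transport N) = 1 :=
  (Unitary.mem_iff.1 (S.transport_mem_unitary N)).2

lemma norm_transport_le : ‖S.transport N‖ ≤ 1 :=
  norm_le_one_of_mem_unitary (S.transport_mem_unitary N)

variable {N}

lemma transport_mul_H (hN : N ≤ m) (h : ZMod m → ℂ) :
    S.transport N * S.H h = S.H (fun x => h (x - N)) * S.transport N := by
  rw [transport, star_u_pow_mul_H]
  congr 3
  funext x
  rw [Nat.cast_sub hN, ZMod.natCast_self, zero_sub, ← sub_eq_add_neg]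

lemma H_mul_transport (hN : N ≤ m) (h : ZMod m → ℂ) :
    S.H h * S.transport N = S.transport N * S.H (fun x => h (x + N)) := by
  rw [transport_mul_H S hN]
  simp

variable {r}

omit [NeZero m] in
lemma star_offFun : star (offFun m r) = offFun m r := by
  funext x
  simp [offFun]

omit [NeZero m] in
lemma star_diagFun : star (diagFun m r N) = diagFun m r N := by
  funext x
  simp [diagFun]

lemma star_H_offFun : star (S.H (offFun m r)) = S.H (offFun m r) := by
  rw [← map_star, star_offFun]

lemma star_H_diagFun : star (S.H (diagFun m r N)) = S.H (diagFun m r N) := by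
  rw [← map_star, star_diagFun]

/-- The square is sorted by powers of `V`: the terms with two like factors vanish (`e₁`, `e₂`), the
single powers are the off-diagonal identity (`e₃`, `e₄`), and the rest is the diagonal one (`e₅`,
`e₆`). -/
lemma isStarProjection_rotation (hr : 0 < r) (hrN : r ≤ N) (hm : N + r ≤ m) :
    IsStarProjection (S.rotation r N) := by
  have hNm : N ≤ m := by lia
  set V := S.transport N with hV
  set P := S.H (diagFun m r N) with hP
  set D := S.H (offFun m r) with hD
  have e₁ : D * V * D = 0 := by
    rw [hD, hV, H_mul_transport S hNm, mul_assoc, ← map_mul]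
    convert mul_zero _
    convert map_zero S.H
    funext x
    rw [Pi.mul_apply, mul_comm]
    exact offFun_mul_shift hr hrN hm x
  have e₂ : D * star V * D = 0 := by
    have := congrArg star e₁
    rwa [star_mul, star_mul, star_H_offFun, star_zero, ← mul_assoc] at this
  have e₃ : P * V * D + V * D * P = V * D := by
    rw [hP, hV, hD, H_mul_transport S hNm, mul_assoc, mul_assoc, ← map_mul, ← map_mul, ← mul_add,
      ← map_add]
    congr 2
    funext x
    simpa only [Pi.add_apply, Pi.mul_apply, mul_add, mul_comm, add_comm] using
      offFun_mul_diagFun hr hrN hm x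
  have e₄ : D * star V * P + P * D * star V = D * star V := by
    have := congrArg star e₃
    simpa only [star_add, star_mul, hD, hP, star_H_offFun, star_H_diagFun, mul_assoc] using this
  have e₅ : V * D * (D * star V) + (P * P + D * D) = P := by
    have : V * D * (D * star V)
        = S.H (fun x => offFun m r (x - N) * offFun m r (x - N)) := by
      rw [hD, hV, mul_assoc, ← mul_assoc (S.H _), ← mul_assoc, ← map_mul, transport_mul_H S hNm,
        mul_assoc, transport_mul_star, mul_one]
      rfl
    rw [this, hP, hD, ← map_mul, ← map_mul, ← map_add, ← map_add]
    congr 1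
    funext x
    simpa only [Pi.add_apply, Pi.mul_apply, add_comm] using diagFun_eq hr hrN hm x
  have e₆ : D * star V * (V * D) = D * D := by
    rw [mul_assoc, ← mul_assoc (star V), S.star_transport_mul, one_mul]
  refine ⟨?_, ?_⟩
  · change (P + V * D + D * star V) * (P + V * D + D * star V) = P + V * D + D * star V
    calc _ = (V * D * (D * star V) + (P * P + D * star V * (V * D)))
          + (P * V * D + V * D * P) + (D * star V * P + P * D * star V)
          + V * (D * V * D) + (D * star V * D) * star V := by noncomm_ring
      _ = _ := by rw [e₁, e₂, e₃, e₄, e₆, e₅]; simp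
  · change star (P + V * D + D * star V) = P + V * D + D * star V
    rw [star_add, star_add, star_mul, star_mul, star_star, hD, hP, star_H_offFun, star_H_diagFun]
    abel

lemma rotation_mem {B : StarSubalgebra ℂ A} (hH : ∀ h, S.H h ∈ B)
    (hu : ∀ h : ZMod m → ℂ, h r = 0 → S.u * S.H h ∈ B) (hr : 0 < r) (hrN : r ≤ N)
    (hm : N + r ≤ m) : S.rotation r N ∈ B := by
  have h : S.transport N * S.H (offFun m r) ∈ B := by
    refine S.star_u_pow_mul_H_mem hH hu _ _ fun x hx j hj hxj => ?_
    have h := offFun_ne_zero hr hx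
    rw [sub_eq_iff_eq_add, ← ZMod.natCast_zmod_val x] at hxj
    norm_cast at hxj
    rw [ZMod.natCast_eq_natCast_iff] at hxj
    -- From `j < m - N` and `r ≤ N` comes `r + 1 + j ≤ m < x + m`. A positive difference divisible
    -- by `m` is at least `m`, which forces `x ≥ r + 1 + j`, against `x < r`.
    have h' : (x.val + m) ≡ (r + 1 + j) [MOD m] := (Nat.add_modEq_right).trans hxj
    have := (h'.symm.dvd)
    rcases (show r + 1 + j < x.val + m ∨ x.val + m ≤ r + 1 + j by lia) with hlt | hlt
    · rw [← Nat.cast_sub hlt.le, Int.natCast_dvd_natCast] at this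
      have := Nat.le_of_dvd (by lia) this
      lia
    · lia
  refine add_mem (add_mem (hH _) h) ?_
  have := star_mem h
  rwa [star_mul, star_H_offFun] at this

/-- At height `r` the ramp has just reached 1 and `s` is 0. The translate of the support of `s` lies
strictly above `N ≥ r`, so it misses this level too. -/
lemma rotation_mul_H_single (hr : 0 < r) (hrN : r ≤ N) (hm : N + r ≤ m) :
    S.rotation r N * S.H (Pi.single (r : ZMod m) 1) = S.H (Pi.single (r : ZMod m) 1) := by
  have hNm : N ≤ m := by lia
  have hrv : (r : ZMod m).val = r := ZMod.val_cast_of_lt (by lia)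
  have h₁ : S.H (diagFun m r N) * S.H (Pi.single (r : ZMod m) 1) =
      S.H (Pi.single (r : ZMod m) 1) := by
    rw [← map_mul]
    congr 1
    funext x
    by_cases hx : x = r
    · subst hx
      simp [diagFun, hrv, diagCoeff_of_le_left hrN, ramp_of_le hr le_rfl]
    · simp [hx]
  have h₂ : S.H (offFun m r) * S.H (Pi.single (r : ZMod m) 1) = 0 := by
    rw [← map_mul]
    convert map_zero S.H
    funext x
    by_cases hx : x = r
    · subst hx
      simp [offFun, hrv, offCoeff_of_le hr le_rfl]
    · simp [hx]
  have h₃ : S.H (offFun m r) * star (S.transport N) * S.H (Pi.single (r : ZMod m) 1) = 0 := by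
    have : S.H (Pi.single (r : ZMod m) 1) * (S.transport N * S.H (offFun m r)) = 0 := by
      rw [← mul_assoc, H_mul_transport S hNm, mul_assoc, ← map_mul]
      convert mul_zero _
      convert map_zero S.H
      funext x
      by_cases hx : offFun m r x = 0
      · simp [hx]
      · have hne : x + N ≠ (r : ZMod m) := by
          intro h
          have h' := val_add_of_offFun_ne_zero hr hm hx
          rw [h, hrv] at h'
          have := offFun_ne_zero hr hx
          lia
        simp [hne]
    have := congrArg star this
    rwa [star_mul, star_mul, star_zero, star_H_offFun, ← map_star, ← Pi.single_star, star_one]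
      at this
  rw [rotation, add_mul, add_mul, h₁, mul_assoc, h₂, h₃, mul_zero, add_zero, add_zero]

lemma norm_rotation_mul_u_sub_le (hr : 0 < r) (hrN : r ≤ N) (hm : N + r ≤ m) :
    ‖S.rotation r N * S.u - S.u * S.rotation r N‖ ≤ 2 / r + 2 * √(1 / r) := by
  have comm : ∀ (h : ZMod m → ℂ), S.H h * S.u - S.u * S.H h
      = S.u * S.H (fun x => h (x + 1) - h x) := by
    intro h
    have := S.u_mul_H (fun x => h (x + 1))
    simp only [sub_add_cancel] at this
    rw [← this, ← mul_sub, ← map_sub]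
    rfl
  have hu : ‖S.u‖ ≤ 1 := norm_le_one_of_mem_unitary S.u_mem
  have hd : ‖S.H (diagFun m r N) * S.u - S.u * S.H (diagFun m r N)‖ ≤ 2 / r := by
    rw [comm]
    calc _ ≤ ‖S.u‖ * _ := norm_mul_le _ _
      _ ≤ 1 * (2 / r) := by
        gcongr
        exact S.norm_H_le (by positivity) (norm_diagFun_succ_sub_le hr hrN hm)
      _ = _ := one_mul _
  have ho : ‖S.H (offFun m r) * S.u - S.u * S.H (offFun m r)‖ ≤ √(1 / r) := by
    rw [comm]
    calc _ ≤ ‖S.u‖ * _ := norm_mul_le _ _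
      _ ≤ 1 * √(1 / r) := by
        gcongr
        exact S.norm_H_le (by positivity) (norm_offFun_succ_sub_le hr (by lia))
      _ = _ := one_mul _
  have hV : S.u * S.transport N = S.transport N * S.u := by
    have : Commute S.u (star S.u) := by
      rw [Commute, SemiconjBy, S.u_mul_star_u, S.star_u_mul_u]
    exact (this.pow_right _).eq
  have hV' : S.u * star (S.transport N) = star (S.transport N) * S.u := by
    rw [transport, star_pow, star_star]
    exact ((Commute.refl S.u).pow_right _).eq
  have hV₁ := S.norm_transport_le N
  have hV₂ : ‖star (S.transport N)‖ ≤ 1 := by rwa [norm_star]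
  have hsplit : S.rotation r N * S.u - S.u * S.rotation r N
      = (S.H (diagFun m r N) * S.u - S.u * S.H (diagFun m r N))
        + S.transport N * (S.H (offFun m r) * S.u - S.u * S.H (offFun m r))
        + (S.H (offFun m r) * S.u - S.u * S.H (offFun m r)) * star (S.transport N) := by
    rw [rotation, mul_sub, sub_mul, mul_assoc _ S.u (star _), hV', ← mul_assoc _ S.u (S.H _), ← hV]
    noncomm_ring
  rw [hsplit]
  calc _ ≤ 2 / r + 1 * √(1 / r) + √(1 / r) * 1 := by
        refine norm_add_le_of_le (norm_add_le_of_le hd ((norm_mul_le _ _).trans ?_))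
          ((norm_mul_le _ _).trans ?_) <;> gcongr
    _ = _ := by ring

/-- The profiles commute with `a`, so only `V` and `V⋆` contribute, and `[a, V⋆] = V⋆ [V, a] V⋆` has
no larger norm than `[V, a]`. -/
lemma norm_rotation_mul_sub_le {a : A} (ha : ∀ h, S.H h * a = a * S.H h) :
    ‖S.rotation r N * a - a * S.rotation r N‖
      ≤ 2 * ‖S.transport N * a - a * S.transport N‖ := by
  set V := S.transport N with hV
  set D := S.H (offFun m r) with hD
  have hV₂ : ‖star V‖ ≤ 1 := by rw [norm_star]; exact S.norm_transport_le N
  have hDn : ‖D‖ ≤ 1 := S.norm_H_le zero_le_one norm_offFun_le_one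
  have hsplit : S.rotation r N * a - a * S.rotation r N
      = (V * a - a * V) * D - D * (star V * (V * a - a * V) * star V) := by
    have h₁ : star V * (V * a - a * V) * star V = a * star V - star V * a := by
      rw [mul_sub, sub_mul, ← mul_assoc, S.star_transport_mul, one_mul, mul_assoc, mul_assoc a,
        S.transport_mul_star, mul_one]
    rw [h₁, rotation, add_mul, add_mul, mul_add, mul_add, ha, mul_assoc _ _ a, ha, mul_sub,
      ← mul_assoc D a, ha]
    noncomm_ring
  rw [hsplit]
  calc _ ≤ ‖V * a - a * V‖ * 1 + 1 * (1 * ‖V * a - a * V‖ * 1) := by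
        refine norm_sub_le_of_le ((norm_mul_le _ _).trans ?_) ((norm_mul_le _ _).trans ?_)
        · gcongr
        · gcongr
          refine (norm_mul_le _ _).trans ?_
          gcongr
          refine (norm_mul_le _ _).trans ?_
          gcongr
    _ = _ := by ring

/-- `V` carries the support of `s` to a set disjoint from it. Cycling the indicator `g` of that
support round the trace kills both off-diagonal terms. -/
lemma re_tracial_rotation_le (hr : 0 < r) (hrN : r ≤ N) (hm : N + r ≤ m) {τ : A →ₗ[ℂ] ℂ}
    (hτ : IsTracialState τ) : m * (τ (S.rotation r N)).re ≤ N + r := by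
  classical
  set g : ZMod m → ℂ := fun x => if offFun m r x = 0 then 0 else 1
  have hg : S.H (offFun m r) * S.H g = S.H (offFun m r) := by
    rw [← map_mul]
    congr 1
    funext x
    by_cases hx : offFun m r x = 0 <;> simp [g, hx]
  have hg' : S.H g * (S.transport N * S.H (offFun m r)) = 0 := by
    rw [← mul_assoc, H_mul_transport S (by lia), mul_assoc, ← map_mul]
    convert mul_zero _
    convert map_zero S.H
    funext x
    rcases mul_eq_zero.1 (offFun_mul_shift hr hrN hm x) with h | h <;> simp [g, h]
  have h₁ : τ (S.transport N * S.H (offFun m r)) = 0 := by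
    conv_lhs => rw [← hg, ← mul_assoc, hτ.map_mul_comm, hg', map_zero]
  have hg'' : S.H g * S.H (offFun m r) = S.H (offFun m r) := by
    rw [← map_mul, mul_comm, map_mul, hg]
  have h₂ : τ (S.H (offFun m r) * star (S.transport N)) = 0 := by
    have : S.H (offFun m r) * star (S.transport N) * S.H g = 0 := by
      have hs := congrArg star hg'
      have hsg : star (S.H g) = S.H g := by
        rw [← map_star]
        congr 1
        funext x
        by_cases hx : offFun m r x = 0 <;> simp [g, hx]
      rwa [star_mul, star_mul, star_zero, star_H_offFun, hsg] at hs
    conv_lhs => rw [← hg'', mul_assoc, hτ.map_mul_comm, this, map_zero]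
  have h₃ := S.tracial_H hτ (diagFun m r N)
  rw [rotation, map_add, map_add, h₁, h₂, add_zero, add_zero]
  have h₄ : (m * τ (S.H (diagFun m r N))).re = m * (τ (S.H (diagFun m r N))).re := by
    simp
  rw [← h₄, h₃]
  exact re_sum_diagFun_le hr

end CyclicTower

open Filter Topology

/-! ### Approximately central projections -/

section Compression

variable {A : Type*} [CStarAlgebra A] {p : ℕ → A}

lemma norm_le_one_of_isStarProjection {q : A} (hq : IsStarProjection q) : ‖q‖ ≤ 1 := by
  have h : ‖q‖ * ‖q‖ = ‖q‖ := by
    rw [← CStarRing.norm_star_mul_self, hq.isSelfAdjoint.star_eq, hq.isIdempotentElem.eq]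
  nlinarith [norm_nonneg q]

/-- The elements which asymptotically commute with a sequence of projections. -/
def AsympCommutes (p : ℕ → A) (a : A) : Prop :=
  ∀ ε > 0, ∀ᶠ k in atTop, ‖p k * a - a * p k‖ < ε

/-- The elements whose compressions are asymptotically compressions of elements of `B`. -/
def AsympCompressed (p : ℕ → A) (B : StarSubalgebra ℂ A) (a : A) : Prop :=
  ∀ ε > 0, ∀ᶠ k in atTop, ∃ c ∈ B, ‖p k * a * p k - p k * c * p k‖ < ε

namespace AsympCommutes

lemma add {a b : A} (ha : AsympCommutes p a) (hb : AsympCommutes p b) :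
    AsympCommutes p (a + b) := fun ε hε => by
  filter_upwards [ha _ (half_pos hε), hb _ (half_pos hε)] with k h₁ h₂
  rw [show p k * (a + b) - (a + b) * p k
    = (p k * a - a * p k) + (p k * b - b * p k) by noncomm_ring]
  linarith [norm_add_le (p k * a - a * p k) (p k * b - b * p k)]

lemma algebraMap (c : ℂ) : AsympCommutes p (algebraMap ℂ A c) := fun ε hε => by
  filter_upwards with k
  rw [Algebra.commutes, sub_self, norm_zero]
  exact hε

lemma mul {a b : A} (ha : AsympCommutes p a) (hb : AsympCommutes p b) :
    AsympCommutes p (a * b) := fun ε hε => by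
  have hb' : 0 < ε / 2 / (‖b‖ + 1) := by positivity
  have ha' : 0 < ε / 2 / (‖a‖ + 1) := by positivity
  filter_upwards [ha _ hb', hb _ ha'] with k h₁ h₂
  rw [lt_div_iff₀ (by positivity)] at h₁ h₂
  rw [show p k * (a * b) - (a * b) * p k
    = (p k * a - a * p k) * b + a * (p k * b - b * p k) by noncomm_ring]
  have n₁ := norm_mul_le (p k * a - a * p k) b
  have n₂ := norm_mul_le a (p k * b - b * p k)
  have n₃ := norm_add_le ((p k * a - a * p k) * b) (a * (p k * b - b * p k))
  nlinarith [norm_nonneg (p k * a - a * p k), norm_nonneg (p k * b - b * p k)]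

lemma star (hp : ∀ k, IsStarProjection (p k)) {a : A} (ha : AsympCommutes p a) :
    AsympCommutes p (star a) := fun ε hε => by
  filter_upwards [ha ε hε] with k h
  rw [← norm_star, star_sub, star_mul, star_mul, star_star, (hp k).isSelfAdjoint.star_eq,
    norm_sub_rev]
  exact h

lemma of_approx (hp : ∀ k, IsStarProjection (p k)) {a : A}
    (h : ∀ δ > 0, ∃ b, ‖a - b‖ < δ ∧ AsympCommutes p b) : AsympCommutes p a := fun ε hε => by
  obtain ⟨b, hab, hb⟩ := h (ε / 3) (by positivity)
  filter_upwards [hb (ε / 3) (by positivity)] with k hk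
  have hpk := norm_le_one_of_isStarProjection (hp k)
  rw [show p k * a - a * p k = p k * (a - b) + (p k * b - b * p k) - (a - b) * p k by
    noncomm_ring]
  have n₁ : ‖p k * (a - b)‖ ≤ 1 * ‖a - b‖ := (norm_mul_le _ _).trans (by gcongr)
  have n₂ : ‖(a - b) * p k‖ ≤ ‖a - b‖ * 1 := (norm_mul_le _ _).trans (by gcongr)
  have n₃ := norm_sub_le (p k * (a - b) + (p k * b - b * p k)) ((a - b) * p k)
  have n₄ := norm_add_le (p k * (a - b)) (p k * b - b * p k)
  linarith

end AsympCommutes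

namespace AsympCompressed

variable {B : StarSubalgebra ℂ A}

lemma of_eq {a : A} (h : ∀ k, ∃ c ∈ B, p k * a * p k = p k * c * p k) :
    AsympCompressed p B a := fun ε hε => by
  filter_upwards with k
  obtain ⟨c, hc, h'⟩ := h k
  exact ⟨c, hc, by rwa [h', sub_self, norm_zero]⟩

lemma add {a b : A} (ha : AsympCompressed p B a) (hb : AsympCompressed p B b) :
    AsympCompressed p B (a + b) := fun ε hε => by
  filter_upwards [ha _ (half_pos hε), hb _ (half_pos hε)] with k ⟨c, hc, h₁⟩ ⟨d, hd, h₂⟩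
  refine ⟨c + d, add_mem hc hd, ?_⟩
  rw [show p k * (a + b) * p k - p k * (c + d) * p k
    = (p k * a * p k - p k * c * p k) + (p k * b * p k - p k * d * p k) by noncomm_ring]
  linarith [norm_add_le (p k * a * p k - p k * c * p k) (p k * b * p k - p k * d * p k)]

/-- Almost commuting with `b` gives `q a b q ≈ (q a q)(q b q)`, which is approximated by `q (c q d)
q`. Here `c q d` is in `B` because `q` is. -/
lemma mul (hp : ∀ k, IsStarProjection (p k)) (hpB : ∀ k, p k ∈ B) {a b : A}
    (hb' : AsympCommutes p b) (ha : AsympCompressed p B a) (hb : AsympCompressed p B b) :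
    AsympCompressed p B (a * b) := fun ε hε => by
  have h₀ : 0 < ε / 3 / (‖a‖ + 1) := by positivity
  have h₁ : 0 < ε / 3 / (‖b‖ + 1) := by positivity
  -- The extra bound by 1 controls `‖q c q‖` by `‖a‖ + 1`, as `c` itself has no a priori bound.
  filter_upwards [ha _ (lt_min h₁ one_pos), hb _ h₀, hb' _ h₀] with k ⟨c, hc, hck⟩
    ⟨d, hd, hdk⟩ hk
  have hpk := norm_le_one_of_isStarProjection (hp k)
  have hpp := (hp k).isIdempotentElem.eq
  obtain ⟨hck, hck₁⟩ := lt_min_iff.1 hck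
  rw [lt_div_iff₀ (by positivity)] at hck hdk hk
  set q := p k
  have hsmall : ‖q * c * q‖ ≤ ‖a‖ + 1 := by
    have n₁ : ‖q * a * q‖ ≤ 1 * ‖a‖ * 1 := by
      refine (norm_mul_le _ _).trans ?_
      gcongr
      refine (norm_mul_le _ _).trans ?_
      gcongr
    rw [norm_sub_rev] at hck₁
    linarith [norm_le_norm_add_norm_sub' (q * c * q) (q * a * q)]
  refine ⟨c * q * d, mul_mem (mul_mem hc (hpB k)) hd, ?_⟩
  have hq : ∀ x, q * (q * x) = q * x := fun x => by rw [← mul_assoc, hpp]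
  have key : q * (a * b) * q - q * (c * q * d) * q
      = (q * a) * ((b * q - q * b) * q) + (q * a * q - q * c * q) * (b * q)
        + (q * c * q) * (q * b * q - q * d * q) := by
    simp only [mul_sub, sub_mul, mul_assoc, hpp, hq]
    abel
  have n₁ : ‖(q * a) * ((b * q - q * b) * q)‖ ≤ (1 * ‖a‖) * (‖q * b - b * q‖ * 1) := by
    rw [norm_sub_rev (q * b)]
    refine (norm_mul_le _ _).trans ?_
    gcongr <;> refine (norm_mul_le _ _).trans ?_ <;> gcongr
  have n₂ : ‖(q * a * q - q * c * q) * (b * q)‖ ≤ ‖q * a * q - q * c * q‖ * (‖b‖ * 1) := by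
    refine (norm_mul_le _ _).trans ?_
    gcongr
    refine (norm_mul_le _ _).trans ?_
    gcongr
  have n₃ : ‖(q * c * q) * (q * b * q - q * d * q)‖
      ≤ (‖a‖ + 1) * ‖q * b * q - q * d * q‖ := by
    refine (norm_mul_le _ _).trans ?_
    gcongr
  rw [key]
  have n₄ := norm_add₃_le (a := (q * a) * ((b * q - q * b) * q))
    (b := (q * a * q - q * c * q) * (b * q)) (c := (q * c * q) * (q * b * q - q * d * q))
  nlinarith [norm_nonneg (q * b - b * q), norm_nonneg (q * a * q - q * c * q)]

lemma star (hp : ∀ k, IsStarProjection (p k)) {a : A} (ha : AsympCompressed p B a) :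
    AsympCompressed p B (star a) := fun ε hε => by
  filter_upwards [ha ε hε] with k ⟨c, hc, h⟩
  refine ⟨_, star_mem hc, ?_⟩
  rw [← norm_star]
  simpa only [star_sub, star_mul, star_star, (hp k).isSelfAdjoint.star_eq, mul_assoc] using h

lemma of_approx (hp : ∀ k, IsStarProjection (p k)) {a : A}
    (h : ∀ δ > 0, ∃ b, ‖a - b‖ < δ ∧ AsympCompressed p B b) : AsympCompressed p B a :=
  fun ε hε => by
  obtain ⟨b, hab, hb⟩ := h (ε / 2) (by positivity)
  filter_upwards [hb (ε / 2) (by positivity)] with k ⟨c, hc, hk⟩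
  have hpk := norm_le_one_of_isStarProjection (hp k)
  refine ⟨c, hc, ?_⟩
  rw [show p k * a * p k - p k * c * p k
    = p k * (a - b) * p k + (p k * b * p k - p k * c * p k) by noncomm_ring]
  have n₁ : ‖p k * (a - b) * p k‖ ≤ 1 * ‖a - b‖ * 1 := by
    refine (norm_mul_le _ _).trans ?_
    gcongr
    refine (norm_mul_le _ _).trans ?_
    gcongr
  have n₂ := norm_add_le (p k * (a - b) * p k) (p k * b * p k - p k * c * p k)
  linarith

end AsympCompressed

end Compression

/-! ### Density of the generated algebra in the crossed product -/

section Density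

variable {K : Type} [TopologicalSpace K] [CompactSpace K] {γ : K ≃ₜ K}

lemma CrossedProduct.dense_induction {Q : CrossedProduct γ → Prop}
    (ofFun : ∀ f, Q (ofFun γ f)) (u : Q (u γ)) (algebraMap : ∀ c : ℂ, Q (algebraMap ℂ _ c))
    (add : ∀ a b, Q a → Q b → Q (a + b)) (mul : ∀ a b, Q a → Q b → Q (a * b))
    (star : ∀ a, Q a → Q (star a))
    (of_approx : ∀ a, (∀ δ > 0, ∃ b, ‖a - b‖ < δ ∧ Q b) → Q a) (a : CrossedProduct γ) : Q a := by
  have key : ∀ b ∈ StarAlgebra.adjoin ℂ (Set.range (universalFun γ) ∪ {universalUnitary γ}),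
      ∃ c : CrossedProduct γ, c.1 = b ∧ Q c := by
    intro b hb
    induction hb using StarAlgebra.adjoin_induction with
    | mem x hx =>
      rcases hx with ⟨f, rfl⟩ | rfl
      · exact ⟨_, rfl, ofFun f⟩
      · exact ⟨_, rfl, u⟩
    | algebraMap c => exact ⟨_, rfl, algebraMap c⟩
    | add x y _ _ hx hy =>
      obtain ⟨x', rfl, hx⟩ := hx
      obtain ⟨y', rfl, hy⟩ := hy
      exact ⟨x' + y', rfl, add _ _ hx hy⟩
    | mul x y _ _ hx hy =>
      obtain ⟨x', rfl, hx⟩ := hx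
      obtain ⟨y', rfl, hy⟩ := hy
      exact ⟨x' * y', rfl, mul _ _ hx hy⟩
    | star x _ hx =>
      obtain ⟨x', rfl, hx⟩ := hx
      exact ⟨Star.star x', rfl, star _ hx⟩
  refine of_approx a fun δ hδ => ?_
  obtain ⟨b, hb, hab⟩ := Metric.mem_closure_iff.1 a.2 δ hδ
  obtain ⟨c, rfl, hc⟩ := key b hb
  refine ⟨c, ?_, hc⟩
  rw [dist_eq_norm] at hab
  exact hab

lemma CrossedProduct.u_mem_unitary : u γ ∈ unitary (CrossedProduct γ) := by
  rw [Unitary.mem_iff]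
  constructor
  · refine Subtype.ext (lp.ext (funext fun ρ => ?_))
    exact (Unitary.mem_iff.1 ρ.U_mem).1
  · refine Subtype.ext (lp.ext (funext fun ρ => ?_))
    exact (Unitary.mem_iff.1 ρ.U_mem).2

lemma CrossedProduct.u_mul_ofFun_mul_star_u (f : C(K, ℂ)) :
    u γ * ofFun γ f * star (u γ) = ofFun γ (f.comp (γ.symm : C(K, K))) :=
  Subtype.ext (lp.ext (funext fun ρ => ρ.covariant f))

lemma CrossedProduct.star_u_pow_mul_ofFun (l : ℕ) {f g : C(K, ℂ)}
    (hg : ∀ z, g z = f (γ^[l] z)) :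
    star (u γ) ^ l * ofFun γ f = ofFun γ g * star (u γ) ^ l := by
  induction l generalizing f with
  | zero =>
    have : g = f := ContinuousMap.ext hg
    simp [this]
  | succ l ih =>
    have h₁ : star (u γ) * ofFun γ f = ofFun γ (f.comp (γ : C(K, K))) * star (u γ) := by
      have hc : (f.comp (γ : C(K, K))).comp (γ.symm : C(K, K)) = f := by
        ext z
        simp
      have h := u_mul_ofFun_mul_star_u (γ := γ) (f.comp (γ : C(K, K)))
      rw [hc] at h
      rw [← h, mul_assoc, ← mul_assoc (star _), (Unitary.mem_iff.1 u_mem_unitary).1, one_mul]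
    rw [pow_succ, mul_assoc, h₁, ← mul_assoc, ih, mul_assoc]
    intro z
    rw [hg, Function.iterate_succ_apply']
    rfl

lemma CrossedProduct.norm_star_u_pow_mul_ofFun_sub_le (l : ℕ) (f : C(K, ℂ)) {δ : ℝ} (hδ : 0 ≤ δ)
    (hf : ∀ z, ‖f (γ^[l] z) - f z‖ ≤ δ) :
    ‖star (u γ) ^ l * ofFun γ f - ofFun γ f * star (u γ) ^ l‖ ≤ δ := by
  have hcont : Continuous fun z => f (γ^[l] z) := f.continuous.comp (γ.continuous.iterate l)
  rw [star_u_pow_mul_ofFun l (g := ⟨_, hcont⟩) fun z => rfl, ← sub_mul, ← map_sub]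
  have h₁ : ‖star (u γ) ^ l‖ ≤ 1 :=
    norm_le_one_of_mem_unitary (pow_mem (Unitary.star_mem u_mem_unitary) l)
  calc _ ≤ _ * ‖star (u γ) ^ l‖ := norm_mul_le _ _
    _ ≤ δ * 1 := by
      gcongr
      refine (NonUnitalStarAlgHom.norm_apply_le _ _).trans ?_
      exact (ContinuousMap.norm_le _ hδ).2 hf
    _ = δ := mul_one _

end Density

/-! ### An odometer along which `β` returns to the identity -/

section Dynamics

/-- Taking `j = M i` in the hypothesis compares `β^(M i)` with the identity. If `M` is unbounded, a
tail of it serves as `m`. If it is bounded, it is eventually a constant `c`, so `β^c = id` exactly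
and `m i = c · 2^(i + 1)` works. -/
lemma IsLimitOfPeriodic.exists_odometerData {n : ℕ} {β : UnitSphere n ≃ₜ UnitSphere n}
    (hβ : IsLimitOfPeriodic β) : ∃ D : OdometerData, ∀ δ : ℝ, 0 < δ →
      ∀ᶠ i in atTop, ∀ t, dist (β^[D.m i] t) t ≤ δ := by
  obtain ⟨T, M, hM, hdvd, hT, hlim⟩ := hβ
  have hret : ∀ δ : ℝ, 0 < δ → ∀ᶠ i in atTop, ∀ t, dist (β^[M i] t) t ≤ δ := fun δ hδ => by
    filter_upwards [hlim δ hδ] with i hi t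
    have := hi t (M i) (Finset.mem_Icc.2 ⟨hM i, le_rfl⟩)
    rwa [hT] at this
  have hmono : Monotone M := monotone_nat_of_le_succ fun i => Nat.le_of_dvd (hM _) (hdvd i)
  by_cases hunb : ∃ C, ∀ i, M i ≤ C
  · obtain ⟨C, hC⟩ := hunb
    obtain ⟨c, hc⟩ : ∃ c, ∀ᶠ i in atTop, M i = c := by
      have h := tendsto_atTop_ciSup hmono ⟨C, by rintro _ ⟨i, rfl⟩; exact hC i⟩
      exact ⟨_, (tendsto_pure.1 (by rwa [nhds_discrete] at h))⟩
    have hc1 : 1 ≤ c := by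
      obtain ⟨i, hi⟩ := hc.exists
      exact hi ▸ hM i
    have hβc : ∀ t, β^[c] t = t := fun t => by
      refine dist_le_zero.1 (le_of_forall_pos_le_add fun δ hδ => ?_)
      obtain ⟨i, hi, h⟩ := (hc.and (hret δ hδ)).exists
      rw [zero_add, ← hi]
      exact h t
    have hpow : ∀ i : ℕ, i < 2 ^ (i + 1) := fun i =>
      (Nat.lt_two_pow_self).trans (Nat.pow_lt_pow_right (by norm_num) (Nat.lt_succ_self i))
    refine ⟨⟨fun i => c * 2 ^ (i + 1), fun i => ?_, fun i => ?_, ?_⟩, fun δ hδ => ?_⟩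
    · have : 1 ≤ 2 ^ i := Nat.one_le_two_pow
      rw [pow_succ]
      nlinarith
    · exact Nat.mul_dvd_mul_left c (pow_dvd_pow 2 (Nat.le_succ _))
    · refine tendsto_atTop_mono (fun i => ?_) tendsto_id
      have := hpow i
      simp only [id]
      nlinarith
    · refine Eventually.of_forall fun i t => ?_
      have : β^[c * 2 ^ (i + 1)] t = t := by
        rw [Function.iterate_mul]
        exact Function.IsFixedPt.iterate (hβc t) _
      rw [this, dist_self]
      exact hδ.le
  · push Not at hunb
    have htop : Tendsto M atTop atTop :=
      tendsto_atTop_atTop_of_monotone hmono fun C => (hunb C).imp fun i hi => hi.le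
    obtain ⟨i₀, hi₀⟩ := (htop.eventually_ge_atTop 2).exists
    refine ⟨⟨fun i => M (i + i₀), fun i => hi₀.trans (hmono (Nat.le_add_left _ _)), fun i => ?_,
      htop.comp (tendsto_add_atTop_nat i₀)⟩, fun δ hδ => ?_⟩
    · rw [add_right_comm]
      exact hdvd _
    · exact (tendsto_add_atTop_nat i₀).eventually (hret δ hδ)

variable {n : ℕ} {D : OdometerData} {β : UnitSphere n ≃ₜ UnitSphere n}

lemma OdometerData.dvd_of_le (D : OdometerData) {i j : ℕ} (h : i ≤ j) : D.m i ∣ D.m j := by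
  induction j, h using Nat.le_induction with
  | base => exact dvd_rfl
  | succ j _ ih => exact ih.trans (D.dvd j)

instance (D : OdometerData) (i : ℕ) : NeZero (D.m i) := ⟨by have := D.two_le i; lia⟩

lemma odometerProd_iterate (l : ℕ) (z : Odometer D × UnitSphere n) :
    (odometerProd D β)^[l] z = ((Odometer.addOne D)^[l] z.1, β^[l] z.2) :=
  congrFun (Prod.map_iterate (Odometer.addOne D) β l) z

lemma Odometer.addOne_iterate_apply (l : ℕ) (x : Odometer D) (j : ℕ) :
    ((Odometer.addOne D)^[l] x).1 j = x.1 j + l := by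
  induction l generalizing x with
  | zero => simp
  | succ l ih =>
    rw [Function.iterate_succ_apply, ih]
    change x.1 j + 1 + l = _
    push_cast
    ring

lemma Odometer.continuous_coord (D : OdometerData) (j : ℕ) :
    Continuous fun x : Odometer D => x.1 j :=
  (continuous_apply j).comp continuous_subtype_val

/-- By compactness, locally uniform convergence suffices. Coordinate `j` of the odometer is fixed
exactly once `i ≥ j`, as `m j ∣ m i`; the sphere coordinate is handled by `hret`. -/
lemma eventually_norm_iterate_sub_le
    (hret : ∀ δ : ℝ, 0 < δ → ∀ᶠ i in atTop, ∀ t, dist (β^[D.m i] t) t ≤ δ)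
    (f : C(Odometer D × UnitSphere n, ℂ)) {δ : ℝ} (hδ : 0 < δ) :
    ∀ᶠ i in atTop, ∀ z, ‖f ((odometerProd D β)^[D.m i] z) - f z‖ ≤ δ := by
  have h : TendstoUniformly (fun i z => f ((odometerProd D β)^[D.m i] z)) f atTop := by
    rw [← tendstoLocallyUniformly_iff_tendstoUniformly_of_compactSpace,
      tendstoLocallyUniformly_iff_filter]
    intro z₀
    have hz : Tendsto (fun q : ℕ × (Odometer D × UnitSphere n) =>
        (odometerProd D β)^[D.m q.1] q.2) (atTop ×ˢ 𝓝 z₀) (𝓝 z₀) := by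
      simp only [odometerProd_iterate]
      refine Tendsto.prodMk_nhds ?_ ?_
      · refine tendsto_subtype_rng.2 (tendsto_pi_nhds.2 fun j => ?_)
        have h₁ : Tendsto (fun q : ℕ × (Odometer D × UnitSphere n) => q.2.1.1 j)
            (atTop ×ˢ 𝓝 z₀) (𝓝 (z₀.1.1 j)) :=
          (((Odometer.continuous_coord D j).comp continuous_fst).tendsto z₀).comp tendsto_snd
        refine h₁.congr' ?_
        filter_upwards [tendsto_fst.eventually (eventually_ge_atTop j)] with q hq
        rw [Odometer.addOne_iterate_apply,
          (ZMod.natCast_eq_zero_iff _ _).2 (D.dvd_of_le hq), add_zero]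
      · refine Metric.tendsto_nhds.2 fun η hη => ?_
        have h₁ : Tendsto (fun q : ℕ × (Odometer D × UnitSphere n) => q.2.2)
            (atTop ×ˢ 𝓝 z₀) (𝓝 z₀.2) := (continuous_snd.tendsto z₀).comp tendsto_snd
        filter_upwards [tendsto_fst.eventually (hret (η / 2) (half_pos hη)),
          Metric.tendsto_nhds.1 h₁ _ (half_pos hη)] with q h₂ h₃
        linarith [dist_triangle (β^[D.m q.1] q.2.2) q.2.2 z₀.2, h₂ q.2.2]
    have hf : Tendsto f (𝓝 z₀) (𝓝 (f z₀)) := f.continuous.tendsto z₀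
    exact ((hf.comp tendsto_snd).prodMk_nhds (hf.comp hz)).mono_right
      (nhds_le_uniformity (f z₀))
  filter_upwards [Metric.tendstoUniformly_iff.1 h δ hδ] with i hi z
  rw [← dist_eq_norm, dist_comm]
  exact (hi z).le

/-- The functions on `X × Sⁿ` factoring through `x ↦ x i - y i + r`, as a copy of the functions
on `ℤ/(m i)`. -/
def levelFun (n : ℕ) (D : OdometerData) (y : Odometer D) (i r : ℕ) :
    (ZMod (D.m i) → ℂ) →⋆ₐ[ℂ] C(Odometer D × UnitSphere n, ℂ) where
  toFun h := ⟨fun z => h (z.1.1 i - y.1 i + r), (continuous_of_discreteTopology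
    (f := fun k : ZMod (D.m i) => h (k - y.1 i + r))).comp
      ((Odometer.continuous_coord D i).comp continuous_fst)⟩
  map_one' := rfl
  map_mul' _ _ := rfl
  map_zero' := rfl
  map_add' _ _ := rfl
  commutes' _ := rfl
  map_star' _ := rfl

/-- The cyclic tower over the cylinder of level `i` around `y`, with `y` at height `r`. -/
noncomputable def odometerTower (β : UnitSphere n ≃ₜ UnitSphere n) (y : Odometer D) (i r : ℕ) :
    CyclicTower (CrossedProduct (odometerProd D β)) (D.m i) where
  u := CrossedProduct.u _
  u_mem := CrossedProduct.u_mem_unitary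
  H := (CrossedProduct.ofFun _).comp (levelFun n D y i r)
  covariant h := by
    rw [StarAlgHom.comp_apply, CrossedProduct.u_mul_ofFun_mul_star_u]
    change _ = CrossedProduct.ofFun _ _
    congr 1
    ext z
    change h (z.1.1 i - 1 - y.1 i + r) = h (z.1.1 i - y.1 i + r - 1)
    congr 1
    ring

lemma ofFun_mem_fibreBreaking (y : Odometer D) (f : C(Odometer D × UnitSphere n, ℂ)) :
    CrossedProduct.ofFun _ f ∈ fibreBreaking D β y :=
  StarSubalgebra.le_topologicalClosure _
    (StarAlgebra.subset_adjoin ℂ _ (Or.inl (Set.mem_range_self f)))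

lemma u_mul_ofFun_mem_fibreBreaking (y : Odometer D) {f : C(Odometer D × UnitSphere n, ℂ)}
    (hf : ∀ t, f (y, t) = 0) :
    CrossedProduct.u _ * CrossedProduct.ofFun _ f ∈ fibreBreaking D β y :=
  StarSubalgebra.le_topologicalClosure _ (StarAlgebra.subset_adjoin ℂ _ (Or.inr ⟨f, by
    rintro ⟨x, t⟩ ⟨rfl, -⟩
    exact hf t, rfl⟩))

lemma odometerTower_u_mul_H_mem (y : Odometer D) (i r : ℕ) (h : ZMod (D.m i) → ℂ) (hr : h r = 0) :
    (odometerTower β y i r).u * (odometerTower β y i r).H h ∈ fibreBreaking D β y := by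
  refine u_mul_ofFun_mem_fibreBreaking y fun t => ?_
  change h (y.1 i - y.1 i + r) = 0
  rw [sub_self, zero_add, hr]

end Dynamics

/-! ### Assembling the projections -/

section Main

variable {n : ℕ} {D : OdometerData} {β : UnitSphere n ≃ₜ UnitSphere n}

/-- A single rotation projection, with all of its estimates. -/
lemma exists_rotation_projection (y : Odometer D) {i j r : ℕ} (hr : 0 < r)
    (hrj : r ≤ D.m j) (hm : D.m j + r ≤ D.m i) :
    ∃ e ∈ fibreBreaking D β y, IsStarProjection e ∧
      ‖e * CrossedProduct.u _ - CrossedProduct.u _ * e‖ ≤ 2 / r + 2 * √(1 / r) ∧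
      (∃ c ∈ fibreBreaking D β y, (1 - e) * CrossedProduct.u _ * (1 - e) = (1 - e) * c * (1 - e)) ∧
      (∀ τ : CrossedProduct (odometerProd D β) →ₗ[ℂ] ℂ, IsTracialState τ →
        D.m i * (τ e).re ≤ D.m j + r) ∧
      ∀ (f : C(Odometer D × UnitSphere n, ℂ)) (δ : ℝ), 0 ≤ δ →
        (∀ z, ‖f ((odometerProd D β)^[D.m i] z) - f z‖ ≤ δ) →
        (∀ z, ‖f ((odometerProd D β)^[D.m j] z) - f z‖ ≤ δ) →
        ‖e * CrossedProduct.ofFun _ f - CrossedProduct.ofFun _ f * e‖ ≤ 4 * δ := by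
  set S := odometerTower β y i r with hS
  have hH : ∀ h, S.H h ∈ fibreBreaking D β y := fun h => ofFun_mem_fibreBreaking y _
  have hu := odometerTower_u_mul_H_mem (β := β) y i r
  refine ⟨S.rotation r (D.m j), S.rotation_mem hH hu hr hrj hm,
    S.isStarProjection_rotation hr hrj hm, S.norm_rotation_mul_u_sub_le hr hrj hm, ?_,
    fun τ hτ => S.re_tracial_rotation_le hr hrj hm hτ, fun f δ hδ h₁ h₂ => ?_⟩
  -- Since `e` is 1 on the level of `y`, the factor `1 - e` absorbs the indicator of the
  -- complementary levels, and `u` can be cut off there.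
  · refine ⟨S.u * S.H (1 - Pi.single (r : ZMod (D.m i)) 1), hu _ (by simp), ?_⟩
    have hs := S.rotation_mul_H_single hr hrj hm
    have hs' : S.H (Pi.single (r : ZMod (D.m i)) 1) * S.rotation r (D.m j)
        = S.H (Pi.single (r : ZMod (D.m i)) 1) := by
      have := congrArg star hs
      rwa [star_mul, ← map_star, ← Pi.single_star, star_one,
        (S.isStarProjection_rotation hr hrj hm).isSelfAdjoint.star_eq] at this
    have h : S.H (1 - Pi.single (r : ZMod (D.m i)) 1) * (1 - S.rotation r (D.m j))
        = 1 - S.rotation r (D.m j) := by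
      rw [map_sub, map_one, sub_mul, one_mul, mul_sub, mul_one, hs', sub_self, sub_zero]
    rw [mul_assoc (1 - S.rotation r (D.m j)) (S.u * _), mul_assoc S.u, h, ← mul_assoc]
    rfl
  · refine (S.norm_rotation_mul_sub_le fun h => ?_).trans ?_
    · change CrossedProduct.ofFun _ _ * _ = _ * CrossedProduct.ofFun _ _
      rw [← map_mul, ← map_mul, mul_comm]
    · have := CrossedProduct.norm_star_u_pow_mul_ofFun_sub_le (γ := odometerProd D β)
        (D.m i - D.m j) f (δ := δ + δ) (by positivity) fun z => ?_
      · calc _ ≤ 2 * (δ + δ) := by gcongr; exact this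
          _ = 4 * δ := by ring
      -- The point reached after `m i - m j` steps is compared with the one `m j` steps later, which
      -- is the `m i`-th iterate of `z`. Each return costs `δ`.
      · have h₃ := h₂ ((odometerProd D β)^[D.m i - D.m j] z)
        rw [← Function.iterate_add_apply, Nat.add_sub_cancel' (by lia), norm_sub_rev] at h₃
        exact (norm_sub_le_norm_sub_add_norm_sub _ _ _).trans (add_le_add h₃ (h₁ z))

/-- The projections of the theorem, as a single sequence that works for all finite sets. -/
lemma exists_seq_projection
    (hret : ∀ δ : ℝ, 0 < δ → ∀ᶠ i in atTop, ∀ t, dist (β^[D.m i] t) t ≤ δ) (y : Odometer D) :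
    ∃ p : ℕ → CrossedProduct (odometerProd D β), (∀ k, p k ∈ fibreBreaking D β y) ∧
      (∀ k, IsStarProjection (p k)) ∧ (∀ a, AsympCommutes p a) ∧
      (∀ a, AsympCompressed p (fibreBreaking D β y) a) ∧
      ∀ ε > 0, ∀ᶠ k in atTop, ∀ τ : CrossedProduct (odometerProd D β) →ₗ[ℂ] ℂ,
        IsTracialState τ → (τ (1 - p k)).re < ε := by
  -- The ramp length is `r = k + 1`. The index `j` makes `N = m j ≥ r`, and `i` is then so large
  -- that `(N + r) / m i ≤ 1 / (k + 1)`, the trace bound. Requiring `i, j ≥ k` makes both return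
  -- times improve with `k`.
  have hj : ∀ k, ∃ j ≥ k, k + 1 ≤ D.m j := fun k =>
    ((eventually_ge_atTop k).and (D.unbounded.eventually_ge_atTop (k + 1))).exists
  choose j hjk hj using hj
  have hi : ∀ k, ∃ i ≥ k, (D.m (j k) + (k + 1)) * (k + 1) ≤ D.m i := fun k =>
    ((eventually_ge_atTop k).and (D.unbounded.eventually_ge_atTop _)).exists
  choose i hik hi using hi
  choose e heB he heu hec heτ hef using fun k => exists_rotation_projection (β := β) y
    (i := i k) (Nat.succ_pos k) (hj k) ((Nat.le_mul_of_pos_right _ (Nat.succ_pos k)).trans (hi k))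
  have hcomm : ∀ k a, (1 - e k) * a - a * (1 - e k) = -(e k * a - a * e k) := fun k a => by
    noncomm_ring
  have hp : ∀ k, IsStarProjection (1 - e k) := fun k => (he k).one_sub
  have hpB : ∀ k, 1 - e k ∈ fibreBreaking D β y := fun k => sub_mem (one_mem _) (heB k)
  have hcast : Tendsto (fun k : ℕ => (1 : ℝ) / (k + 1 : ℕ)) atTop (𝓝 0) := by
    simpa using tendsto_one_div_add_atTop_nhds_zero_nat (𝕜 := ℝ)
  have hofFun : ∀ f, AsympCommutes (fun k => 1 - e k)
      (CrossedProduct.ofFun (odometerProd D β) f) := by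
    intro f ε hε
    have h := eventually_norm_iterate_sub_le hret f (δ := ε / 8) (by positivity)
    filter_upwards [(tendsto_atTop_mono hik tendsto_id).eventually h,
      (tendsto_atTop_mono hjk tendsto_id).eventually h] with k h₁ h₂
    rw [hcomm, norm_neg]
    linarith [hef k f (ε / 8) (by positivity) h₁ h₂]
  have hu : AsympCommutes (fun k => 1 - e k) (CrossedProduct.u (odometerProd D β)) := by
    intro ε hε
    have h : Tendsto (fun k : ℕ => 2 * ((1 : ℝ) / (k + 1 : ℕ)) + 2 * √(1 / (k + 1 : ℕ))) atTop
        (𝓝 (2 * 0 + 2 * √0)) := (hcast.const_mul 2).add (hcast.sqrt.const_mul 2)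
    simp only [mul_zero, Real.sqrt_zero, add_zero] at h
    filter_upwards [h.eventually_lt_const hε] with k hk
    rw [hcomm, norm_neg]
    refine (heu k).trans_lt (lt_of_le_of_lt (le_of_eq ?_) hk)
    ring
  have hall : ∀ a, AsympCommutes (fun k => 1 - e k) a := fun a =>
    CrossedProduct.dense_induction hofFun hu AsympCommutes.algebraMap
      (fun _ _ => AsympCommutes.add) (fun _ _ => AsympCommutes.mul) (fun _ => AsympCommutes.star hp)
      (fun _ => AsympCommutes.of_approx hp) a
  refine ⟨fun k => 1 - e k, hpB, hp, hall, fun a => ?_, fun ε hε => ?_⟩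
  · exact CrossedProduct.dense_induction
      (fun f => AsympCompressed.of_eq fun k => ⟨_, ofFun_mem_fibreBreaking y f, rfl⟩)
      (AsympCompressed.of_eq hec)
      (fun c => AsympCompressed.of_eq fun k => ⟨_, algebraMap_mem _ c, rfl⟩)
      (fun _ _ => AsympCompressed.add) (fun a b => AsympCompressed.mul hp hpB (hall b))
      (fun _ => AsympCompressed.star hp) (fun _ => AsympCompressed.of_approx hp) a
  · filter_upwards [hcast.eventually_lt_const hε] with k hk τ hτ
    rw [sub_sub_cancel]
    refine lt_of_le_of_lt ?_ hk
    have h₁ := heτ k τ hτ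
    have h₂ : (((D.m (j k) + (k + 1)) * (k + 1) : ℕ) : ℝ) ≤ D.m (i k) := by exact_mod_cast hi k
    rw [le_div_iff₀ (by positivity)]
    by_contra! hlt
    have hk0 : (0 : ℝ) < (k + 1 : ℕ) := by positivity
    have hs : (0 : ℝ) < (D.m (j k) : ℝ) + (k + 1 : ℕ) := by positivity
    have hpos : 0 < (τ (e k)).re := by
      by_contra! h
      nlinarith
    push_cast at h₁ h₂ hlt hs hk0
    nlinarith [mul_le_mul_of_nonneg_right h₂ hpos.le]

end Main

theorem lemma4p3 (n : ℕ) (hn : Odd n) (hn3 : 3 ≤ n) (β : UnitSphere n ≃ₜ UnitSphere n)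
    (hβ : IsLimitOfPeriodic β) :
    ∃ D : OdometerData,
      ∀ (y : Odometer D) (F : Finset (CrossedProduct (odometerProd D β))) (ε : ℝ), 0 < ε →
        ∃ p : CrossedProduct (odometerProd D β),
          p ∈ fibreBreaking D β y ∧ IsStarProjection p ∧
          (∀ a ∈ F, ‖p * a - a * p‖ < ε) ∧
          (∀ a ∈ F, Metric.infDist (p * a * p)
            {b | ∃ c ∈ fibreBreaking D β y, b = p * c * p} < ε) ∧
          (∀ τ : CrossedProduct (odometerProd D β) →ₗ[ℂ] ℂ, IsTracialState τ →
            (τ (1 - p)).re < ε) := by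
  obtain ⟨D, hret⟩ := hβ.exists_odometerData
  refine ⟨D, fun y F ε hε => ?_⟩
  obtain ⟨p, hpB, hp, hcomm, hcompr, hτ⟩ := exists_seq_projection hret y
  have h₁ : ∀ᶠ k in atTop, ∀ a ∈ F, ‖p k * a - a * p k‖ < ε :=
    (Finset.eventually_all F).2 fun a _ => hcomm a ε hε
  have h₂ : ∀ᶠ k in atTop, ∀ a ∈ F, ∃ c ∈ fibreBreaking D β y,
      ‖p k * a * p k - p k * c * p k‖ < ε :=
    (Finset.eventually_all F).2 fun a _ => hcompr a ε hε
  obtain ⟨k, ⟨hk₁, hk₂⟩, hk₃⟩ := ((h₁.and h₂).and (hτ ε hε)).exists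
  refine ⟨p k, hpB k, hp k, hk₁, fun a ha => ?_, hk₃⟩
  obtain ⟨c, hc, hlt⟩ := hk₂ a ha
  have hmem : p k * c * p k ∈ {b | ∃ c ∈ fibreBreaking D β y, b = p k * c * p k} := ⟨c, hc, rfl⟩
  refine (Metric.infDist_le_dist_of_mem hmem).trans_lt ?_
  rwa [dist_eq_norm]
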